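/- For complex $z$ with $\sinh z\neq 0$ let $\coth z=\cosh z/\sinh z$, and let $\zeta$ be the Riemann zeta function. Let $x,y$ be nonzero real numbers. (i) For every nonzero complex number $a$ (in particular for every nonzero real $a$) such that $xa\notin\mathbb Z$ and $ya\notin i\mathbb Z$ (the latter being automatic for nonzero real $a$), the series below converges absolutely and $$\pi^2xy\cot(\pi xa)\coth(\pi ya)=\frac1{a^2}+2\zeta(2)(y^2-x^2)-2\pi xy\sum_{n=1}^\infty\left\{\frac{a^2x^2\coth(\pi ny/x)}{n(n^2-a^2x^2)}+\frac{a^2y^2\coth(\pi nx/y)}{n(n^2+a^2y^2)}\right\}.$$ (ii) In particular (the case $a=1$), if $x\notin\mathbb Z$, then the series below converges absolutely and $$\pi^2xy\cot(\pi x)\coth(\pi y)=1+2\zeta(2)(y^2-x^2)-2\pi xy\sum_{n=1}^\infty\left\{\frac{x^2\coth(\pi ny/x)}{n(n^2-x^2)}+\frac{y^2\coth(\pi nx/y)}{n(n^2+y^2)}\right\},$$ which is Sitaramachandrarao's formula. -/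

import Mathlib

/-- Hyperbolic cotangent of a complex argument (used only where `sinh z ≠ 0`). -/
noncomputable def hypCoth (z : ℂ) : ℂ := Complex.cosh z / Complex.sinh z

/-- The `n`-th bracket (for `n ≥ 1`) of the partial fraction expansion of
`cot (π x a) * coth (π y a)`. -/
noncomputable def cotCothTerm (x y : ℝ) (a : ℂ) (n : ℕ) : ℂ :=
  a ^ 2 * x ^ 2 * hypCoth (Real.pi * n * y / x) / (n * (n ^ 2 - a ^ 2 * x ^ 2)) +
    a ^ 2 * y ^ 2 * hypCoth (Real.pi * n * x / y) / (n * (n ^ 2 + a ^ 2 * y ^ 2))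

/-! Let `U = πx cot(πxa) - 1/a = ∑ u_n` and `V = πy coth(πya) - 1/a = ∑ v_m` be the Mittag-Leffler
series. Partial fractions split `u_n v_m` into multiples of `u_n / (m²x² + n²y²)` and `v_m / (m²x² +
n²y²)`, each absolutely summable over pairs (`cot_hypCoth_partial_fraction`,
`summable_mul_inv_quadratic`). Summing out the index absent from the numerator gives `coth(πny/x)`
and `coth(πmx/y)` minus polar terms (`hasSum_inv_quadratic`). The polar terms are absorbed by `(U +
V)/a` and `ζ(2)`, and `UV + (U + V)/a = (U + 1/a)(V + 1/a) - 1/a²`. -/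

lemma HasSum.congr_fun_of_eq {ι : Type*} {f g : ι → ℂ} {a b : ℂ} (h : HasSum f a)
    (hfg : ∀ i, g i = f i) (hab : b = a) : HasSum g b :=
  hab ▸ h.congr_fun hfg

/-- Mittag-Leffler expansion of the cotangent, with the poles `± n` paired. -/
lemma hasSum_cot_pi_mul {w : ℂ} (hw : ∀ m : ℤ, w ≠ m) :
    HasSum (fun n : ℕ => 2 * w / (w ^ 2 - ((n : ℂ) + 1) ^ 2))
      (Real.pi * Complex.cot (Real.pi * w) - 1 / w) := by
  have hw' : w ∈ Complex.integerComplement := by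
    rintro ⟨m, hm⟩
    exact hw m hm.symm
  have h := (summable_cotTerm hw').hasSum
  have h2 : ∑' n : ℕ, cotTerm w n = Real.pi * Complex.cot (Real.pi * w) - 1 / w :=
    (cot_series_rep' hw').symm
  rw [h2] at h
  refine h.congr_fun fun n => ?_
  rw [cotTerm_identity hw', mul_one_div]
  congr 1
  ring

lemma cot_mul_I (z : ℂ) : Complex.cot (z * Complex.I) = -Complex.I * hypCoth z := by
  rw [Complex.cot, hypCoth, Complex.cos_mul_I, Complex.sin_mul_I, mul_comm (Complex.sinh z),
    div_mul_eq_div_div_swap, Complex.div_I]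
  ring

/-- Mittag-Leffler expansion of the hyperbolic cotangent, with the poles `± n i` paired. -/
lemma hasSum_hypCoth_pi_mul {w : ℂ} (hw : ∀ m : ℤ, w ≠ m * Complex.I) :
    HasSum (fun n : ℕ => 2 * w / (w ^ 2 + ((n : ℂ) + 1) ^ 2))
      (Real.pi * hypCoth (Real.pi * w) - 1 / w) := by
  have hI : ∀ m : ℤ, w * Complex.I ≠ m := by
    intro m hm
    apply hw (-m)
    push_cast
    linear_combination (-Complex.I) * hm + w * Complex.I_sq
  have h := (hasSum_cot_pi_mul hI).mul_left Complex.I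
  rw [← mul_assoc (Real.pi : ℂ), cot_mul_I] at h
  refine h.congr_fun_of_eq (fun n => ?_) ?_
  · rw [mul_pow, Complex.I_sq, ← neg_neg (2 * w), ← neg_div_neg_eq, ← mul_div_assoc]
    congr 1
    · linear_combination -(2 * w) * Complex.I_sq
    · ring
  · rw [one_div, one_div, mul_inv, Complex.inv_I]
    linear_combination (Real.pi * hypCoth (Real.pi * w) - w⁻¹) * Complex.I_sq

lemma ofReal_ne_intCast_mul_I {c : ℝ} (hc : c ≠ 0) (m : ℤ) : (c : ℂ) ≠ m * Complex.I := by
  intro h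
  apply hc
  simpa using congrArg Complex.re h

/-- One-dimensional sums of the reciprocal of the quadratic form `p² x² + q² y²`. -/
lemma hasSum_inv_quadratic {x y : ℝ} (hx : x ≠ 0) (hy : y ≠ 0) (n : ℕ) :
    HasSum (fun m : ℕ => 1 / (((m : ℂ) + 1) ^ 2 * x ^ 2 + ((n : ℂ) + 1) ^ 2 * y ^ 2))
      ((Real.pi * hypCoth (Real.pi * ((n : ℂ) + 1) * y / x) - x / (((n : ℂ) + 1) * y)) /
        (2 * ((n : ℂ) + 1) * x * y)) := by
  have hn : ((n : ℂ) + 1) ≠ 0 := Nat.cast_add_one_ne_zero n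
  have hxC : (x : ℂ) ≠ 0 := Complex.ofReal_ne_zero.2 hx
  have hyC : (y : ℂ) ≠ 0 := Complex.ofReal_ne_zero.2 hy
  have hc : (((n : ℝ) + 1) * y / x) ≠ 0 := by positivity
  have h := (hasSum_hypCoth_pi_mul (ofReal_ne_intCast_mul_I hc)).div_const
    (2 * ((n : ℂ) + 1) * x * y)
  push_cast at h
  rw [one_div_div, ← mul_div_assoc (Real.pi : ℂ), ← mul_assoc (Real.pi : ℂ)] at h
  refine h.congr_fun fun m => ?_
  have hpos : (0 : ℝ) < ((m : ℝ) + 1) ^ 2 * x ^ 2 + ((n : ℝ) + 1) ^ 2 * y ^ 2 := by positivity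
  have h1 : ((m : ℂ) + 1) ^ 2 * x ^ 2 + ((n : ℂ) + 1) ^ 2 * y ^ 2 ≠ 0 := by
    exact_mod_cast hpos.ne'
  have h2 : (((n : ℂ) + 1) * y / x) ^ 2 + ((m : ℂ) + 1) ^ 2 =
      (((m : ℂ) + 1) ^ 2 * x ^ 2 + ((n : ℂ) + 1) ^ 2 * y ^ 2) / x ^ 2 := by
    field_simp
    ring
  rw [h2]
  field_simp

/-- Dropping `n² y²` makes the bound uniform in `n`, so that the double series is dominated by a
product of two single series. -/
lemma norm_inv_quadratic_le {x y : ℝ} (hx : x ≠ 0) (m n : ℕ) :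
    ‖1 / (((m : ℂ) + 1) ^ 2 * x ^ 2 + ((n : ℂ) + 1) ^ 2 * y ^ 2)‖ ≤
      1 / ((m : ℝ) + 1) ^ 2 * (1 / x ^ 2) := by
  have h : 1 / (((m : ℂ) + 1) ^ 2 * x ^ 2 + ((n : ℂ) + 1) ^ 2 * y ^ 2) =
      ((1 / (((m : ℝ) + 1) ^ 2 * x ^ 2 + ((n : ℝ) + 1) ^ 2 * y ^ 2) : ℝ) : ℂ) := by
    push_cast
    rfl
  rw [h, Complex.norm_real, Real.norm_of_nonneg (by positivity), one_div_mul_one_div]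
  apply one_div_le_one_div_of_le (by positivity)
  have : 0 ≤ ((n : ℝ) + 1) ^ 2 * y ^ 2 := by positivity
  linarith

lemma summable_one_div_add_one_sq : Summable fun n : ℕ => 1 / ((n : ℝ) + 1) ^ 2 := by
  have h := (summable_nat_add_iff 1).2 (Real.summable_one_div_nat_pow.2 one_lt_two)
  simpa using h

lemma hasSum_riemannZeta_two : HasSum (fun n : ℕ => 1 / ((n : ℂ) + 1) ^ 2) (riemannZeta 2) := by
  have hs : Summable fun n : ℕ => 1 / ((n : ℂ) + 1) ^ 2 := by
    simpa using Complex.ofRealCLM.summable summable_one_div_add_one_sq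
  have h := zeta_eq_tsum_one_div_nat_add_one_cpow (s := 2) (by simp)
  rw [h]
  convert hs.hasSum using 4 with n
  norm_cast

/-- Weighting the reciprocals of the quadratic form `m² x² + n² y²` by a summable family in `n`
gives a summable double family. -/
lemma summable_mul_inv_quadratic {x : ℝ} (hx : x ≠ 0) (y : ℝ) {u : ℕ → ℂ} (hu : Summable u) :
    Summable fun p : ℕ × ℕ =>
      u p.1 * (1 / (((p.2 : ℂ) + 1) ^ 2 * x ^ 2 + ((p.1 : ℂ) + 1) ^ 2 * y ^ 2)) := by
  refine Summable.of_norm_bounded (hu.norm.mul_of_nonneg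
    (summable_one_div_add_one_sq.mul_right (1 / x ^ 2)) (fun _ => norm_nonneg _)
    (fun _ => by positivity)) fun p => ?_
  rw [norm_mul]
  exact mul_le_mul_of_nonneg_left (norm_inv_quadratic_le hx _ _) (norm_nonneg _)

lemma cot_hypCoth_partial_fraction {X Y a N M : ℂ} (h1 : a ^ 2 * X ^ 2 - N ^ 2 ≠ 0)
    (h2 : a ^ 2 * Y ^ 2 + M ^ 2 ≠ 0) (h3 : M ^ 2 * X ^ 2 + N ^ 2 * Y ^ 2 ≠ 0) :
    2 * a * X ^ 2 / (a ^ 2 * X ^ 2 - N ^ 2) * (2 * a * Y ^ 2 / (a ^ 2 * Y ^ 2 + M ^ 2)) =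
      2 * a * X ^ 2 * Y ^ 2 * (2 * a * X ^ 2 / (a ^ 2 * X ^ 2 - N ^ 2) *
        (1 / (M ^ 2 * X ^ 2 + N ^ 2 * Y ^ 2))) -
      2 * a * X ^ 2 * Y ^ 2 * (2 * a * Y ^ 2 / (a ^ 2 * Y ^ 2 + M ^ 2) *
        (1 / (N ^ 2 * Y ^ 2 + M ^ 2 * X ^ 2))) := by
  rw [add_comm (N ^ 2 * Y ^ 2)]
  generalize hD : a ^ 2 * X ^ 2 - N ^ 2 = D at *
  generalize hE : a ^ 2 * Y ^ 2 + M ^ 2 = E at *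
  generalize hK : M ^ 2 * X ^ 2 + N ^ 2 * Y ^ 2 = K at *
  -- The whole identity is this linear relation divided by `D * E * K`: the `a` terms cancel.
  have : K = X ^ 2 * E - Y ^ 2 * D := by rw [← hD, ← hE, ← hK]; ring
  field_simp
  rw [this]
  ring

/-- The polar terms cancel because `a²x² / (N² D) = 1/N² + 1/D` for `D = a²x² - N²`, and `a²y² / (N²
E) = 1/N² - 1/E` for `E = a²y² + N²`. -/
lemma cotCothTerm_eq {x y : ℝ} (hx : x ≠ 0) (hy : y ≠ 0) {a : ℂ} (ha : a ≠ 0) (n : ℕ)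
    (h1 : a ^ 2 * x ^ 2 - ((n : ℂ) + 1) ^ 2 ≠ 0) (h2 : a ^ 2 * y ^ 2 + ((n : ℂ) + 1) ^ 2 ≠ 0) :
    -2 * Real.pi * x * y * cotCothTerm x y a (n + 1) =
      2 * a * x ^ 2 * y ^ 2 * (2 * a * x ^ 2 / (a ^ 2 * x ^ 2 - ((n : ℂ) + 1) ^ 2) *
        ((Real.pi * hypCoth (Real.pi * ((n : ℂ) + 1) * y / x) - x / (((n : ℂ) + 1) * y)) /
          (2 * ((n : ℂ) + 1) * x * y))) -
      2 * a * x ^ 2 * y ^ 2 * (2 * a * y ^ 2 / (a ^ 2 * y ^ 2 + ((n : ℂ) + 1) ^ 2) *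
        ((Real.pi * hypCoth (Real.pi * ((n : ℂ) + 1) * x / y) - y / (((n : ℂ) + 1) * x)) /
          (2 * ((n : ℂ) + 1) * y * x))) +
      (2 * a * x ^ 2 / (a ^ 2 * x ^ 2 - ((n : ℂ) + 1) ^ 2) * (1 / a) +
        2 * a * y ^ 2 / (a ^ 2 * y ^ 2 + ((n : ℂ) + 1) ^ 2) * (1 / a)) +
      1 / ((n : ℂ) + 1) ^ 2 * (2 * x ^ 2 - 2 * y ^ 2) := by
  have hn : ((n : ℂ) + 1) ≠ 0 := Nat.cast_add_one_ne_zero n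
  have hxC : (x : ℂ) ≠ 0 := Complex.ofReal_ne_zero.2 hx
  have hyC : (y : ℂ) ≠ 0 := Complex.ofReal_ne_zero.2 hy
  rw [cotCothTerm]
  push_cast
  generalize hypCoth (Real.pi * ((n : ℂ) + 1) * y / x) = c
  generalize hypCoth (Real.pi * ((n : ℂ) + 1) * x / y) = d
  generalize (n : ℂ) + 1 = N at *
  have e : N ^ 2 - a ^ 2 * x ^ 2 = -(a ^ 2 * x ^ 2 - N ^ 2) := by ring
  rw [e, add_comm (N ^ 2)]
  generalize hD : a ^ 2 * (x : ℂ) ^ 2 - N ^ 2 = D at *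
  generalize hE : a ^ 2 * (y : ℂ) ^ 2 + N ^ 2 = E at *
  field_simp
  rw [← hD, ← hE]
  ring

theorem hasSum_cotCothTerm {x y : ℝ} (hx : x ≠ 0) (hy : y ≠ 0) {a : ℂ} (ha : a ≠ 0)
    (hxa : ∀ m : ℤ, (x : ℂ) * a ≠ m) (hya : ∀ m : ℤ, (y : ℂ) * a ≠ m * Complex.I) :
    HasSum (fun n : ℕ => -2 * Real.pi * x * y * cotCothTerm x y a (n + 1))
      ((Real.pi : ℂ) ^ 2 * x * y * Complex.cot (Real.pi * x * a) * hypCoth (Real.pi * y * a) -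
        1 / a ^ 2 - 2 * riemannZeta 2 * ((y : ℂ) ^ 2 - (x : ℂ) ^ 2)) := by
  have hxC : (x : ℂ) ≠ 0 := Complex.ofReal_ne_zero.2 hx
  have hyC : (y : ℂ) ≠ 0 := Complex.ofReal_ne_zero.2 hy
  have hD : ∀ n : ℕ, a ^ 2 * (x : ℂ) ^ 2 - ((n : ℂ) + 1) ^ 2 ≠ 0 := by
    intro n h
    have h' : ((x : ℂ) * a - ((n : ℂ) + 1)) * (x * a + ((n : ℂ) + 1)) = 0 := by
      linear_combination h
    rcases mul_eq_zero.1 h' with h' | h'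
    · apply hxa (n + 1)
      push_cast
      linear_combination h'
    · apply hxa (-(n + 1))
      push_cast
      linear_combination h'
  have hE : ∀ n : ℕ, a ^ 2 * (y : ℂ) ^ 2 + ((n : ℂ) + 1) ^ 2 ≠ 0 := by
    intro n h
    have h' : ((y : ℂ) * a - ((n : ℂ) + 1) * Complex.I) *
        (y * a + ((n : ℂ) + 1) * Complex.I) = 0 := by
      linear_combination h - ((n : ℂ) + 1) ^ 2 * Complex.I_sq
    rcases mul_eq_zero.1 h' with h' | h'
    · apply hya (n + 1)
      push_cast
      linear_combination h'
    · apply hya (-(n + 1))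
      push_cast
      linear_combination h'
  have hK : ∀ m n : ℕ, ((m : ℂ) + 1) ^ 2 * x ^ 2 + ((n : ℂ) + 1) ^ 2 * y ^ 2 ≠ 0 := by
    intro m n
    have hpos : (0 : ℝ) < ((m : ℝ) + 1) ^ 2 * x ^ 2 + ((n : ℝ) + 1) ^ 2 * y ^ 2 := by positivity
    exact_mod_cast hpos.ne'
  set u : ℕ → ℂ := fun n => 2 * a * x ^ 2 / (a ^ 2 * x ^ 2 - ((n : ℂ) + 1) ^ 2) with hu_def
  set v : ℕ → ℂ := fun n => 2 * a * y ^ 2 / (a ^ 2 * y ^ 2 + ((n : ℂ) + 1) ^ 2) with hv_def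
  have hu : HasSum u (x * (Real.pi * Complex.cot (Real.pi * (x * a)) - 1 / (x * a))) := by
    refine ((hasSum_cot_pi_mul hxa).mul_left (x : ℂ)).congr_fun fun n => ?_
    simp only [hu_def]
    rw [← mul_div_assoc]
    congr 1 <;> ring
  have hv : HasSum v (y * (Real.pi * hypCoth (Real.pi * (y * a)) - 1 / (y * a))) := by
    refine ((hasSum_hypCoth_pi_mul hya).mul_left (y : ℂ)).congr_fun fun n => ?_
    simp only [hv_def]
    rw [← mul_div_assoc]
    congr 1 <;> ring
  obtain ⟨P, hP⟩ := (summable_mul_inv_quadratic hx y hu.summable)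
  obtain ⟨Q, hQ⟩ := (summable_mul_inv_quadratic hy x hv.summable)
  have hP1 := hP.prod_fiberwise fun n => (hasSum_inv_quadratic hx hy n).mul_left (u n)
  have hQ1 := hQ.prod_fiberwise fun n => (hasSum_inv_quadratic hy hx n).mul_left (v n)
  -- In `Q` the index of `v` comes first; the swap aligns it with `u p.1 * v p.2`.
  have hQ' := (Equiv.prodComm ℕ ℕ).hasSum_iff.2 hQ
  have huv := hu.mul hv (summable_mul_of_summable_norm hu.summable.norm hv.summable.norm)
  have hPQ := (hP.mul_left (2 * a * x ^ 2 * y ^ 2)).sub (hQ'.mul_left (2 * a * x ^ 2 * y ^ 2))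
  -- Thus `U * V = 2ax²y² (P - Q)`, while `hP1` and `hQ1` compute `P` and `Q` as single series.
  have key := huv.unique (hPQ.congr_fun fun p =>
    cot_hypCoth_partial_fraction (hD p.1) (hE p.2) (hK p.2 p.1))
  have hfin := (((hP1.mul_left (2 * a * x ^ 2 * y ^ 2)).sub
    (hQ1.mul_left (2 * a * x ^ 2 * y ^ 2))).add
      ((hu.mul_right (1 / a)).add (hv.mul_right (1 / a)))).add
        (hasSum_riemannZeta_two.mul_right (2 * (x : ℂ) ^ 2 - 2 * (y : ℂ) ^ 2))
  rw [← key] at hfin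
  refine hfin.congr_fun_of_eq (fun n => cotCothTerm_eq hx hy ha n (hD n) (hE n)) ?_
  rw [← mul_assoc (Real.pi : ℂ) (x : ℂ) a, ← mul_assoc (Real.pi : ℂ) (y : ℂ) a]
  field_simp
  ring

theorem mainTheorem8 (x y : ℝ) (hx : x ≠ 0) (hy : y ≠ 0) :
    (∀ a : ℂ, a ≠ 0 → (∀ m : ℤ, (x : ℂ) * a ≠ m) → (∀ m : ℤ, (y : ℂ) * a ≠ m * Complex.I) →
      Summable (fun n : ℕ => cotCothTerm x y a (n + 1)) ∧
      (Real.pi : ℂ) ^ 2 * x * y * Complex.cot (Real.pi * x * a) * hypCoth (Real.pi * y * a) =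
        1 / a ^ 2 + 2 * riemannZeta 2 * ((y : ℂ) ^ 2 - (x : ℂ) ^ 2) -
          2 * Real.pi * x * y * ∑' n : ℕ, cotCothTerm x y a (n + 1)) ∧
    ((∀ m : ℤ, x ≠ m) →
      Summable (fun k : ℕ => let n : ℂ := (k : ℂ) + 1
        (x : ℂ) ^ 2 * hypCoth (Real.pi * n * y / x) / (n * (n ^ 2 - x ^ 2)) +
          (y : ℂ) ^ 2 * hypCoth (Real.pi * n * x / y) / (n * (n ^ 2 + y ^ 2))) ∧
      (Real.pi : ℂ) ^ 2 * x * y * Complex.cot (Real.pi * x) * hypCoth (Real.pi * y) =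
        1 + 2 * riemannZeta 2 * ((y : ℂ) ^ 2 - (x : ℂ) ^ 2) -
          2 * Real.pi * x * y * ∑' k : ℕ, (let n : ℂ := (k : ℂ) + 1
            (x : ℂ) ^ 2 * hypCoth (Real.pi * n * y / x) / (n * (n ^ 2 - x ^ 2)) +
              (y : ℂ) ^ 2 * hypCoth (Real.pi * n * x / y) / (n * (n ^ 2 + y ^ 2)))) := by
  have main : ∀ a : ℂ, a ≠ 0 → (∀ m : ℤ, (x : ℂ) * a ≠ m) →
      (∀ m : ℤ, (y : ℂ) * a ≠ m * Complex.I) →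
      Summable (fun n : ℕ => cotCothTerm x y a (n + 1)) ∧
      (Real.pi : ℂ) ^ 2 * x * y * Complex.cot (Real.pi * x * a) * hypCoth (Real.pi * y * a) =
        1 / a ^ 2 + 2 * riemannZeta 2 * ((y : ℂ) ^ 2 - (x : ℂ) ^ 2) -
          2 * Real.pi * x * y * ∑' n : ℕ, cotCothTerm x y a (n + 1) := by
    intro a ha hxa hya
    have h := hasSum_cotCothTerm hx hy ha hxa hya
    have hc : (-2 * Real.pi * x * y : ℂ) ≠ 0 := by
      simp [hx, hy, Real.pi_ne_zero]
    have hs : Summable (fun n : ℕ => cotCothTerm x y a (n + 1)) :=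
      (summable_mul_left_iff hc).1 h.summable
    refine ⟨hs, ?_⟩
    linear_combination h.unique (hs.hasSum.mul_left _)
  refine ⟨main, fun hxm => ?_⟩
  have h := main 1 one_ne_zero (fun m => by rw [mul_one]; exact_mod_cast hxm m)
    (fun m => by rw [mul_one]; exact ofReal_ne_intCast_mul_I hy m)
  simpa [cotCothTerm] using h
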